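/- Let $k\ge 1$, let $R$ be a $k\times k$ stochastic matrix (non-negative entries, row sums $1$), let $U_0$ be a (deterministic) probability vector in $\mathbb R^k$, and let $w:[0,1]\to[0,\infty)$ be non-increasing. Extend $w$ to $\mathbb R$ by $w(x)=w(0)$ for $x\le 0$ and $w(x)=w(1)$ for $x\ge 1$. For $y\in\mathbb R^k$ (a row vector) put $\mathbf w(y)=(w(y_1),\dots,w(y_k))$, $S_w(y)=\sum_{i=1}^k w(y_i)$ and $F(y)=\frac{\mathbf w(y)}{S_w(y)}R$, and let $\Delta_k\subset\mathbb R^k$ be the set of probability vectors. Consider the negatively reinforced urn scheme with weight function $w$: for $n\ge 0$ let $Y_n=U_n/(n+1)$; a colour $Z_n\in\{1,\dots,k\}$ is selected with $$P(Z_n=j\mid Z_0,\dots,Z_{n-1})=\frac{w(Y_{n,j})}{S_w(Y_n)}\quad\text{a.s.},\qquad 1\le j\le k,$$ and $U_{n+1}=U_n+\chi_{n+1}R$ with $\chi_{n+1}=(\mathbf 1(Z_n=j))_{1\le j\le k}$. Let $N_n=\sum_{m=0}^{n-1}\chi_{m+1}$ be the vector of colour counts and $\tilde Y_n=N_n/n$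 for $n\ge1$. (a) Suppose that $w$ is continuous, that $S_w>0$ on $\Delta_k$, and that $F$ is a contraction on $\Delta_k$ for the Euclidean norm, i.e. there is $c<1$ with $\|F(x)-F(y)\|\le c\|x-y\|$ for all $x,y\in\Delta_k$ (in particular, this is so if $F$ is a contraction of $\mathbb R^k$). Then $F$ has a unique fixed point $y^*$, it lies in $\Delta_k$, and $$Y_n\to y^*\ \text{ a.s.},\qquad \tilde Y_n\to \tilde y^*:=\frac{\mathbf w(y^*)}{S_w(y^*)}\ \text{ a.s.}$$ (b) The same conclusion (existence and uniqueness of the fixed point $y^*$ of $F$, and both almost sure limits) holds whenever $w$ is Lipschitz on $[0,1]$ with constant $M$, $w(1)>0$ and $\sqrt k>\dfrac{2M}{w(1)}$. -/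

import Mathlib

open MeasureTheory Filter
open scoped Topology NNReal ProbabilityTheory

noncomputable section

namespace NegUrn

variable {k : ℕ} {Ω : Type*}

/-- The probability simplex, inside `ℝ^k` with its Euclidean norm. -/
def simplex (k : ℕ) : Set (EuclideanSpace ℝ (Fin k)) :=
  {y | (∀ i, 0 ≤ y i) ∧ ∑ i, y i = 1}

/-- The extension of a weight function `w : [0,1] → ℝ` to all of `ℝ`, equal to `w 0` on `(-∞, 0]`
and to `w 1` on `[1, ∞)`. -/
def extend (w : unitInterval → ℝ) : ℝ → ℝ :=
  Set.IccExtend (zero_le_one : (0 : ℝ) ≤ 1) w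

/-- The total weight `S_w(y) = ∑ i, w (y i)`. -/
def totalWeight (w : unitInterval → ℝ) (y : EuclideanSpace ℝ (Fin k)) : ℝ :=
  ∑ i, extend w (y i)

/-- The vector `𝐰(y) / S_w(y)` of selection probabilities at the colour proportions `y`. -/
def selection (w : unitInterval → ℝ) (y : EuclideanSpace ℝ (Fin k)) : EuclideanSpace ℝ (Fin k) :=
  WithLp.toLp 2 fun i => extend w (y i) / totalWeight w y

/-- The map `F(y) = (𝐰(y) / S_w(y)) R`; vectors are row vectors. -/
def F (w : unitInterval → ℝ) (R : Matrix (Fin k) (Fin k) ℝ) (y : EuclideanSpace ℝ (Fin k)) :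
    EuclideanSpace ℝ (Fin k) :=
  WithLp.toLp 2 (Matrix.vecMul (selection w y).ofLp R)

/-- `f` is a contraction on the set `s`: it is Lipschitz on `s` with a constant less than `1`. -/
def IsContractionOn (f : EuclideanSpace ℝ (Fin k) → EuclideanSpace ℝ (Fin k))
    (s : Set (EuclideanSpace ℝ (Fin k))) : Prop :=
  ∃ c : ℝ≥0, c < 1 ∧ LipschitzOnWith c f s

/-- The indicator row vector of the colour `j`. -/
def indicatorVec (j : Fin k) : EuclideanSpace ℝ (Fin k) :=
  EuclideanSpace.single j 1

/-- The urn configuration: `U 0 = u₀` and `U (n+1) = U n + χ (n+1) R`, where `χ (n+1)` is the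
indicator vector of the `(n+1)`-th selected colour `Z n`. -/
def config (R : Matrix (Fin k) (Fin k) ℝ) (u₀ : EuclideanSpace ℝ (Fin k)) (Z : ℕ → Ω → Fin k) :
    ℕ → Ω → EuclideanSpace ℝ (Fin k)
  | 0, _ => u₀
  | n + 1, ω =>
      config R u₀ Z n ω + WithLp.toLp 2 (Matrix.vecMul (indicatorVec (Z n ω)).ofLp R)

/-- The colour proportions `Y n = U n / (n + 1)`. -/
def proportions (R : Matrix (Fin k) (Fin k) ℝ) (u₀ : EuclideanSpace ℝ (Fin k))
    (Z : ℕ → Ω → Fin k) (n : ℕ) (ω : Ω) : EuclideanSpace ℝ (Fin k) :=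
  ((n : ℝ) + 1)⁻¹ • config R u₀ Z n ω

/-- The colour counts: `N n = ∑_{m < n} χ (m+1)`, whose `j`-th entry is the number of times that the
colour `j` was selected in the first `n` trials. -/
def counts (Z : ℕ → Ω → Fin k) (n : ℕ) (ω : Ω) : EuclideanSpace ℝ (Fin k) :=
  ∑ m ∈ Finset.range n, indicatorVec (Z m ω)

/-- The colour count proportions `N n / n`. -/
def countProportions (Z : ℕ → Ω → Fin k) (n : ℕ) (ω : Ω) : EuclideanSpace ℝ (Fin k) :=
  (n : ℝ)⁻¹ • counts Z n ω

/-- The information in the first `n` selections, `σ(Z 0, …, Z (n-1))`. -/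
abbrev history (Z : ℕ → Ω → Fin k) (n : ℕ) : MeasurableSpace Ω :=
  ⨆ m : Fin n, MeasurableSpace.comap (Z m) inferInstance

/-- `Z 0, Z 1, …` are the successively selected colours of the negatively reinforced urn scheme with
weight function `w`, replacement matrix `R` and initial configuration `u₀`: given the past, the
colour `j` is selected with probability `w (Y n j) / ∑ i, w (Y n i)`. -/
structure IsUrnScheme [MeasurableSpace Ω] (P : Measure Ω) (w : unitInterval → ℝ)
    (R : Matrix (Fin k) (Fin k) ℝ) (u₀ : EuclideanSpace ℝ (Fin k)) (Z : ℕ → Ω → Fin k) : Prop where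
  measurable : ∀ n, Measurable (Z n)
  condProb : ∀ n j, P⟦Z n ⁻¹' {j} | history Z n⟧ =ᵐ[P]
    fun ω => selection w (proportions R u₀ Z n ω) j

/-- `F` has a unique fixed point `y*` in `ℝ^k`, it is a probability vector, and almost surely the
colour proportions converge to `y*` and the colour count proportions to `𝐰(y*) / S_w(y*)`. -/
def Converges [MeasurableSpace Ω] (P : Measure Ω) (w : unitInterval → ℝ)
    (R : Matrix (Fin k) (Fin k) ℝ) (u₀ : EuclideanSpace ℝ (Fin k)) (Z : ℕ → Ω → Fin k) : Prop :=
  ∃ y ∈ simplex k, F w R y = y ∧ (∀ z, F w R z = z → z = y) ∧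
    (∀ᵐ ω ∂P, Tendsto (fun n => proportions R u₀ Z n ω) atTop (𝓝 y)) ∧
    (∀ᵐ ω ∂P, Tendsto (fun n => countProportions Z n ω) atTop (𝓝 (selection w y)))

end NegUrn

end

/-! The urn is a stochastic approximation of the fixed point of `F`: the recursion is `Y (n+1) = Y n
+ (F (Y n) - Y n + D n) / (n+2)`, where `D n` is a bounded martingale difference. With `X n = Y n -
y*`, the contraction property gives `⟪X, F Y - y*⟫ ≤ c ‖X‖²`, so `‖X n‖²` loses on average at least
`2(1-c) ‖X n‖² / (n+2)`, up to a summable error. Once this error is compensated, a bounded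
nonnegative supermartingale results, so `‖X n‖²` converges almost surely. Its limit has mean zero,
since otherwise the divergent harmonic series would exhaust the expectation. This is
`ae_tendsto_zero_of_contracting_recursion`.

The same result with zero drift is a strong law for the averaged noise. The colour counts are noise
plus selection probabilities, and the latter converge in Cesàro mean by continuity.

For (b), an `ℓ¹` estimate (`isContractionOn_F_of_lipschitz`) reduces the claim to (a). -/

/-! ### Convergence of contracting stochastic recursions -/

/-- A nonnegative convergent sequence `a` vanishes in the limit if `b * a n / (n + 2)` bounds the
decrement of a sequence that is bounded below. -/
theorem tendsto_zero_of_harmonic_decrement {a v : ℕ → ℝ} {b L : ℝ} (hb : 0 < b)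
    (ha : ∀ n, 0 ≤ a n) (hv : ∀ n, 0 ≤ v n) (haL : Tendsto a atTop (𝓝 L))
    (hdec : ∀ n, v (n + 1) ≤ v n - b * ((n : ℝ) + 2)⁻¹ * a n) : L = 0 := by
  have hL : 0 ≤ L := ge_of_tendsto' haL ha
  by_contra hne
  have hLpos : 0 < L := lt_of_le_of_ne hL (Ne.symm hne)
  obtain ⟨N, hN⟩ := eventually_atTop.1 (haL.eventually_const_lt (half_lt_self hLpos))
  -- From `N` on, `a` exceeds `L / 2`, so the decrements dominate a multiple of the harmonic tail,
  -- while their sum is at most `v N`.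
  have hsum : ∀ n, ∑ i ∈ Finset.range n, ((i : ℝ) + (N + 2))⁻¹ * (b * (L / 2)) ≤ v N - v (n + N) := by
    intro n
    induction n with
    | zero => simp
    | succ n ih =>
      rw [Finset.sum_range_succ]
      have h1 := hdec (n + N)
      have h2 := (hN (n + N) (by omega)).le
      have h3 : 0 ≤ b * (((n + N : ℕ) : ℝ) + 2)⁻¹ := by positivity
      have h4 := mul_le_mul_of_nonneg_left h2 h3
      have h5 : n + 1 + N = n + N + 1 := by omega
      rw [h5]
      push_cast at h1 h4 ⊢
      rw [← add_assoc (n : ℝ) N 2]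
      linarith
  have hsummable : Summable fun i : ℕ => ((i : ℝ) + (N + 2))⁻¹ * (b * (L / 2)) :=
    summable_of_sum_range_le (c := v N) (fun n => by positivity)
      fun n => (hsum n).trans (by linarith [hv (n + N)])
  have h := (summable_mul_right_iff (by positivity)).1 hsummable
  refine Real.not_summable_natCast_inv ((summable_nat_add_iff (N + 2)).1 ?_)
  simpa using h

/-- A bounded adapted stochastic recursion with step sizes `1 / (n + 2)`, a drift that contracts
towards `0` and a bounded martingale difference noise converges almost surely to `0`. -/
theorem ae_tendsto_zero_of_contracting_recursion {Ω E : Type*} [mΩ : MeasurableSpace Ω]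
    {P : Measure Ω} [IsProbabilityMeasure P] [NormedAddCommGroup E] [InnerProductSpace ℝ E]
    [CompleteSpace E] {ℱ : Filtration ℕ mΩ} {X G D : ℕ → Ω → E} {c B : ℝ} (hc1 : c < 1)
    (hX : StronglyAdapted ℱ X) (hD : ∀ n, StronglyMeasurable (D n))
    (hXB : ∀ n ω, ‖X n ω‖ ≤ B) (hDB : ∀ n ω, ‖D n ω‖ ≤ B)
    (hG : ∀ n ω, ‖G n ω‖ ≤ c * ‖X n ω‖) (hDc : ∀ n, P[D n | ℱ n] =ᵐ[P] 0)
    (hrec : ∀ n ω, X (n + 1) ω = X n ω + ((n : ℝ) + 2)⁻¹ • (G n ω - X n ω + D n ω)) :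
    ∀ᵐ ω ∂P, Tendsto (fun n => X n ω) atTop (𝓝 0) := by
  have hB : 0 ≤ B := by
    obtain ⟨ω⟩ := P.nonempty_of_neZero
    exact (norm_nonneg _).trans (hXB 0 ω)
  -- The increment `G - X + D` has three terms of norm at most `B`.
  set C : ℝ := (3 * B) ^ 2
  have hXm : ∀ n, StronglyMeasurable (X n) := fun n => (hX n).mono (ℱ.le n)
  have hinner_bdd : ∀ n ω, ‖inner ℝ (X n ω) (D n ω)‖ ≤ B * B := fun n ω =>
    (norm_inner_le_norm _ _).trans (mul_le_mul (hXB n ω) (hDB n ω) (norm_nonneg _) hB)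
  have hinner_int : ∀ n, Integrable (fun ω => inner ℝ (X n ω) (D n ω)) P := fun n =>
    .of_bound ((hXm n).inner (hD n)).aestronglyMeasurable (B * B) (.of_forall (hinner_bdd n))
  -- `X n` is known at time `n` and can be pulled out of the conditional expectation.
  have hinner_condExp : ∀ n, P[fun ω => inner ℝ (X n ω) (D n ω) | ℱ n] =ᵐ[P] 0 := by
    intro n
    have h := condExp_bilin_of_aestronglyMeasurable_left (μ := P) (innerSL ℝ (E := E))
      (hX n).aestronglyMeasurable (hinner_int n)
      (Integrable.of_bound (hD n).aestronglyMeasurable B (.of_forall (hDB n)))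
    filter_upwards [h, hDc n] with ω h1 h2
    refine h1.trans ?_
    simp [h2]
  have hsq_int : ∀ n, Integrable (fun ω => ‖X n ω‖ ^ 2) P := fun n =>
    .of_bound ((hXm n).norm.pow 2).aestronglyMeasurable (B ^ 2) (.of_forall fun ω => by
      rw [Real.norm_of_nonneg (by positivity)]
      gcongr
      exact hXB n ω)
  -- The second-order term is at most `C / (n+2)²`, which is at most the decrease of `C / (n+1)` to
  -- `C / (n+2)`. Adding `C / (n+1)` therefore turns `‖X n‖²` into a supermartingale.
  set V : ℕ → Ω → ℝ := fun n ω => ‖X n ω‖ ^ 2 + C * ((n : ℝ) + 1)⁻¹ with hV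
  have hV_int : ∀ n, Integrable (V n) P := fun n => (hsq_int n).add (integrable_const _)
  have hV_meas : StronglyAdapted ℱ V := fun n =>
    ((hX n).norm.pow 2).add stronglyMeasurable_const
  have hV_nonneg : ∀ n ω, 0 ≤ V n ω := fun n ω => by positivity
  have hstep : ∀ n ω, V (n + 1) ω ≤ V n ω - 2 * (1 - c) * ((n : ℝ) + 2)⁻¹ * ‖X n ω‖ ^ 2
      + 2 * ((n : ℝ) + 2)⁻¹ * inner ℝ (X n ω) (D n ω) := by
    intro n ω
    have hn : (0 : ℝ) ≤ ((n : ℝ) + 2)⁻¹ := by positivity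
    have h1 : inner ℝ (X n ω) (G n ω) ≤ c * ‖X n ω‖ ^ 2 := by
      calc inner ℝ (X n ω) (G n ω) ≤ ‖X n ω‖ * ‖G n ω‖ := real_inner_le_norm _ _
        _ ≤ ‖X n ω‖ * (c * ‖X n ω‖) := by gcongr; exact hG n ω
        _ = c * ‖X n ω‖ ^ 2 := by ring
    have h2 : ‖G n ω - X n ω + D n ω‖ ^ 2 ≤ C := by
      have h3 : ‖G n ω‖ ≤ B := (hG n ω).trans
        ((mul_le_of_le_one_left (norm_nonneg _) hc1.le).trans (hXB n ω))
      have h4 : ‖G n ω - X n ω + D n ω‖ ≤ 3 * B := by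
        linarith [norm_add_le (G n ω - X n ω) (D n ω), norm_sub_le (G n ω) (X n ω), hXB n ω, hDB n ω]
      exact pow_le_pow_left₀ (norm_nonneg _) h4 2
    have h5 : (((n : ℝ) + 2)⁻¹) ^ 2 * C ≤ C * ((n : ℝ) + 1)⁻¹ - C * ((n : ℝ) + 2)⁻¹ := by
      have : (((n : ℝ) + 2)⁻¹) ^ 2 ≤ ((n : ℝ) + 1)⁻¹ - ((n : ℝ) + 2)⁻¹ := by
        rw [inv_sub_inv (by positivity) (by positivity),
          show (n : ℝ) + 2 - (n + 1) = 1 by ring, inv_pow, inv_eq_one_div]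
        apply one_div_le_one_div_of_le (by positivity)
        nlinarith
      nlinarith [sq_nonneg (3 * B)]
    have h6 : (((n : ℝ) + 2)⁻¹) ^ 2 * ‖G n ω - X n ω + D n ω‖ ^ 2 ≤ (((n : ℝ) + 2)⁻¹) ^ 2 * C := by
      gcongr
    have h7 : ((n : ℝ) + 2)⁻¹ * inner ℝ (X n ω) (G n ω) ≤ ((n : ℝ) + 2)⁻¹ * (c * ‖X n ω‖ ^ 2) := by
      gcongr
    simp only [hV]
    rw [hrec, norm_add_sq_real, norm_smul, inner_smul_right, inner_add_right, inner_sub_right,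
      real_inner_self_eq_norm_sq, mul_pow, Real.norm_of_nonneg hn]
    push_cast
    rw [add_assoc (n : ℝ) 1 1, one_add_one_eq_two]
    linarith
  have hmono : ∀ n, P[V (n + 1) | ℱ n] ≤ᵐ[P] V n := by
    intro n
    set T : Ω → ℝ := (2 * ((n : ℝ) + 2)⁻¹) • fun ω => inner ℝ (X n ω) (D n ω)
    have hT_int : Integrable T P := (hinner_int n).smul _
    have h1 : P[V (n + 1) | ℱ n] ≤ᵐ[P] P[V n + T | ℱ n] :=
      condExp_mono (hV_int _) ((hV_int n).add hT_int) (.of_forall fun ω => by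
        have h2 : 0 ≤ 2 * (1 - c) * ((n : ℝ) + 2)⁻¹ * ‖X n ω‖ ^ 2 := by
          have := sub_pos.2 hc1
          positivity
        have h3 := hstep n ω
        simp only [T, Pi.add_apply, Pi.smul_apply, smul_eq_mul]
        linarith)
    filter_upwards [h1, condExp_add (hV_int n) hT_int (ℱ n),
      condExp_smul (2 * ((n : ℝ) + 2)⁻¹) (fun ω => inner ℝ (X n ω) (D n ω)) (μ := P) (ℱ n),
      hinner_condExp n] with ω h1 h2 h3 h4
    rw [h2, Pi.add_apply, h3, Pi.smul_apply, h4,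
      condExp_of_stronglyMeasurable (ℱ.le n) (hV_meas n) (hV_int n)] at h1
    simpa using h1
  have hsuper : Supermartingale V ℱ P := supermartingale_nat hV_meas hV_int hmono
  have hVB : ∀ n ω, ‖V n ω‖ ≤ B ^ 2 + C := by
    intro n ω
    rw [Real.norm_of_nonneg (hV_nonneg n ω)]
    have h1 : ((n : ℝ) + 1)⁻¹ ≤ 1 := inv_le_one_of_one_le₀ (by linarith [n.cast_nonneg (α := ℝ)])
    have h2 : C * ((n : ℝ) + 1)⁻¹ ≤ C := mul_le_of_le_one_right (by positivity) h1
    have h3 : ‖X n ω‖ ^ 2 ≤ B ^ 2 := pow_le_pow_left₀ (norm_nonneg _) (hXB n ω) 2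
    simp only [hV]
    linarith
  have hlim : ∀ᵐ ω ∂P, ∃ l, Tendsto (fun n => (-V) n ω) atTop (𝓝 l) := by
    refine hsuper.neg.exists_ae_tendsto_of_bdd (R := (B ^ 2 + C).toNNReal) fun n => ?_
    refine (eLpNorm_le_of_ae_bound (C := B ^ 2 + C) (.of_forall fun ω => ?_)).trans ?_
    · simpa using hVB n ω
    · simp [ENNReal.ofReal]
  have hCto : Tendsto (fun n : ℕ => C * ((n : ℝ) + 1)⁻¹) atTop (𝓝 0) := by
    simpa using (tendsto_one_div_add_atTop_nhds_zero_nat (𝕜 := ℝ)).const_mul C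
  have hlim' : ∀ᵐ ω ∂P, ∃ l, Tendsto (fun n => ‖X n ω‖ ^ 2) atTop (𝓝 l) := by
    filter_upwards [hlim] with ω ⟨l, hl⟩
    refine ⟨-l - 0, ?_⟩
    have := hl.neg.sub hCto
    simpa [hV] using this
  -- A measurable version of the limit is needed in order to integrate it.
  obtain ⟨e, he_meas, he⟩ := measurable_limit_of_tendsto_metrizable_ae
    (fun n => ((hXm n).norm.pow 2).measurable.aemeasurable) hlim'
  replace he : ∀ᵐ ω ∂P, Tendsto (fun n => ‖X n ω‖ ^ 2) atTop (𝓝 (e ω)) := he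
  have hint_lim : Tendsto (fun n => ∫ ω, ‖X n ω‖ ^ 2 ∂P) atTop (𝓝 (∫ ω, e ω ∂P)) :=
    tendsto_integral_of_dominated_convergence (fun _ => B ^ 2)
      (fun n => ((hXm n).norm.pow 2).aestronglyMeasurable) (integrable_const _)
      (fun n => .of_forall fun ω => by
        rw [Real.norm_of_nonneg (by positivity)]
        exact pow_le_pow_left₀ (norm_nonneg _) (hXB n ω) 2) he
  -- In expectation the noise term of `hstep` vanishes, which leaves the harmonic decrement.
  have hzero : ∫ ω, e ω ∂P = 0 := by
    refine tendsto_zero_of_harmonic_decrement (v := fun n => ∫ ω, V n ω ∂P) (b := 2 * (1 - c))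
      (by linarith) (fun n => integral_nonneg fun ω => by positivity)
      (fun n => integral_nonneg (hV_nonneg n)) hint_lim fun n => ?_
    have h0 : ∫ ω, inner ℝ (X n ω) (D n ω) ∂P = 0 := by
      rw [← integral_condExp (ℱ.le n), integral_congr_ae (hinner_condExp n)]
      simp
    have h1 := integral_mono (hV_int (n + 1))
      (((hV_int n).sub ((hsq_int n).const_mul (2 * (1 - c) * ((n : ℝ) + 2)⁻¹))).add
        ((hinner_int n).const_mul (2 * ((n : ℝ) + 2)⁻¹))) (hstep n)
    rw [integral_add' ((hV_int n).sub ((hsq_int n).const_mul _)) ((hinner_int n).const_mul _),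
      integral_sub' (hV_int n) ((hsq_int n).const_mul _), integral_const_mul, integral_const_mul,
      h0] at h1
    simpa using h1
  have he_nonneg : 0 ≤ᵐ[P] e := by
    filter_upwards [he] with ω hω
    exact ge_of_tendsto' hω fun n => by positivity
  have he_int : Integrable e P := by
    refine .of_bound he_meas.aestronglyMeasurable (B ^ 2) ?_
    filter_upwards [he, he_nonneg] with ω hω h0
    rw [Real.norm_of_nonneg h0]
    exact le_of_tendsto' hω fun n => pow_le_pow_left₀ (norm_nonneg _) (hXB n ω) 2
  filter_upwards [he, (integral_eq_zero_iff_of_nonneg_ae he_nonneg he_int).1 hzero] with ω h1 h2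
  rw [h2] at h1
  have h3 := h1.sqrt
  simp only [Real.sqrt_sq (norm_nonneg _), Pi.zero_apply, Real.sqrt_zero] at h3
  exact tendsto_zero_iff_norm_tendsto_zero.2 h3

/-! ### The simplex, stochastic matrices and the selection map -/

namespace NegUrn

variable {k : ℕ} {Ω : Type*} {w : unitInterval → ℝ} {R : Matrix (Fin k) (Fin k) ℝ}

/-- Right multiplication of row vectors by `R`, as a continuous linear map. -/
noncomputable def rowMul (R : Matrix (Fin k) (Fin k) ℝ) :
    EuclideanSpace ℝ (Fin k) →L[ℝ] EuclideanSpace ℝ (Fin k) :=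
  LinearMap.toContinuousLinearMap
    { toFun := fun v => WithLp.toLp 2 (Matrix.vecMul v.ofLp R)
      map_add' := fun v v' => by simp [Matrix.add_vecMul]
      map_smul' := fun a v => by simp [Matrix.smul_vecMul] }

theorem rowMul_apply_coord (v : EuclideanSpace ℝ (Fin k)) (j : Fin k) :
    rowMul R v j = ∑ i, v i * R i j := rfl

theorem F_eq_rowMul (y : EuclideanSpace ℝ (Fin k)) : F w R y = rowMul R (selection w y) := rfl

theorem rowMul_mem_simplex (hR : R ∈ Matrix.rowStochastic ℝ (Fin k))
    {v : EuclideanSpace ℝ (Fin k)} (hv : v ∈ simplex k) : rowMul R v ∈ simplex k := by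
  refine ⟨fun j => ?_, ?_⟩
  · rw [rowMul_apply_coord]
    exact Finset.sum_nonneg fun i _ =>
      mul_nonneg (hv.1 i) (Matrix.nonneg_of_mem_rowStochastic hR)
  · simp only [rowMul_apply_coord]
    rw [Finset.sum_comm]
    simp only [← Finset.mul_sum, Matrix.sum_row_of_mem_rowStochastic hR, mul_one, hv.2]

theorem indicatorVec_mem_simplex (j : Fin k) : indicatorVec j ∈ simplex k := by
  refine ⟨fun i => ?_, ?_⟩
  · by_cases h : i = j <;> simp [indicatorVec, h]
  · simp [indicatorVec]

theorem convex_simplex : Convex ℝ (simplex k) := by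
  intro x hx y hy a b ha hb hab
  refine ⟨fun i => ?_, ?_⟩
  · simpa using add_nonneg (mul_nonneg ha (hx.1 i)) (mul_nonneg hb (hy.1 i))
  · simp [Finset.sum_add_distrib, ← Finset.mul_sum, hx.2, hy.2, hab]

theorem isClosed_simplex : IsClosed (simplex k) := by
  have h1 : IsClosed {y : EuclideanSpace ℝ (Fin k) | ∀ i, 0 ≤ y i} := by
    simp only [Set.ofPred_forall]
    exact isClosed_iInter fun i => isClosed_le continuous_const (by fun_prop)
  exact h1.inter (isClosed_eq (by fun_prop) continuous_const)

theorem norm_le_sum_abs (v : EuclideanSpace ℝ (Fin k)) : ‖v‖ ≤ ∑ i, |v i| := by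
  rw [EuclideanSpace.norm_eq, Real.sqrt_le_left (Finset.sum_nonneg fun i _ => abs_nonneg _)]
  exact Finset.sum_sq_le_sq_sum_of_nonneg fun i _ => abs_nonneg _

theorem sum_abs_le_sqrt_mul_norm (v : EuclideanSpace ℝ (Fin k)) :
    ∑ i, |v i| ≤ √(k : ℝ) * ‖v‖ := by
  rw [EuclideanSpace.norm_eq, ← Real.sqrt_mul (Nat.cast_nonneg k)]
  apply Real.le_sqrt_of_sq_le
  simpa using sq_sum_le_card_mul_sum_sq (s := Finset.univ) (f := fun i => |v i|)

theorem norm_le_one_of_mem_simplex {v : EuclideanSpace ℝ (Fin k)} (hv : v ∈ simplex k) :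
    ‖v‖ ≤ 1 := by
  refine (norm_le_sum_abs v).trans ?_
  simp only [abs_of_nonneg (hv.1 _), hv.2, le_refl]

theorem norm_sub_le_two_of_mem_simplex {v v' : EuclideanSpace ℝ (Fin k)} (hv : v ∈ simplex k)
    (hv' : v' ∈ simplex k) : ‖v - v'‖ ≤ 2 := by
  linarith [norm_sub_le v v', norm_le_one_of_mem_simplex hv, norm_le_one_of_mem_simplex hv']

theorem sum_abs_rowMul_le (hR : R ∈ Matrix.rowStochastic ℝ (Fin k))
    (v : EuclideanSpace ℝ (Fin k)) : ∑ j, |rowMul R v j| ≤ ∑ i, |v i| := by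
  calc ∑ j, |rowMul R v j| ≤ ∑ j, ∑ i, |v i| * R i j := by
        refine Finset.sum_le_sum fun j _ => ?_
        rw [rowMul_apply_coord]
        refine (Finset.abs_sum_le_sum_abs _ _).trans_eq (Finset.sum_congr rfl fun i _ => ?_)
        rw [abs_mul, abs_of_nonneg (Matrix.nonneg_of_mem_rowStochastic hR)]
    _ = ∑ i, |v i| := by
        rw [Finset.sum_comm]
        simp only [← Finset.mul_sum, Matrix.sum_row_of_mem_rowStochastic hR, mul_one]

theorem extend_nonneg (hw : ∀ x, 0 ≤ w x) (t : ℝ) : 0 ≤ extend w t := hw _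

theorem extend_antitone (hw : Antitone w) : Antitone (extend w) :=
  fun _ _ h => hw (Set.monotone_projIcc _ h)

theorem extend_continuous (hw : Continuous w) : Continuous (extend w) :=
  hw.comp continuous_projIcc

theorem abs_extend_sub_le {M : ℝ≥0} (hw : LipschitzWith M w) (s t : ℝ) :
    |extend w s - extend w t| ≤ M * |s - t| := by
  have h := (hw.comp (LipschitzWith.projIcc (zero_le_one (α := ℝ)))).dist_le_mul s t
  simpa [Real.dist_eq, extend, Set.IccExtend] using h

theorem totalWeight_nonneg (hw : ∀ x, 0 ≤ w x) (y : EuclideanSpace ℝ (Fin k)) :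
    0 ≤ totalWeight w y :=
  Finset.sum_nonneg fun _ _ => extend_nonneg hw _

theorem selection_apply (y : EuclideanSpace ℝ (Fin k)) (j : Fin k) :
    selection w y j = extend w (y j) / totalWeight w y := rfl

theorem selection_mem_simplex (hw : ∀ x, 0 ≤ w x) {y : EuclideanSpace ℝ (Fin k)}
    (hy : 0 < totalWeight w y) : selection w y ∈ simplex k := by
  refine ⟨fun i => div_nonneg (extend_nonneg hw _) hy.le, ?_⟩
  simp only [selection_apply, ← Finset.sum_div]
  exact div_self hy.ne'

theorem F_mem_simplex (hw : ∀ x, 0 ≤ w x) (hR : R ∈ Matrix.rowStochastic ℝ (Fin k))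
    {y : EuclideanSpace ℝ (Fin k)} (hy : 0 < totalWeight w y) : F w R y ∈ simplex k :=
  rowMul_mem_simplex hR (selection_mem_simplex hw hy)

theorem continuousAt_selection (hw : Continuous w) {y : EuclideanSpace ℝ (Fin k)}
    (hy : 0 < totalWeight w y) : ContinuousAt (selection w) y := by
  have he := extend_continuous hw
  have hS : Continuous (totalWeight w : EuclideanSpace ℝ (Fin k) → ℝ) :=
    continuous_finsetSum _ fun i _ => he.comp (by fun_prop)
  refine (PiLp.continuous_toLp 2 _).continuousAt.comp (continuousAt_pi.2 fun i => ?_)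
  exact (he.comp (by fun_prop)).continuousAt.div hS.continuousAt hy.ne'

/-- Monotonicity of the weight already gives Borel measurability, without continuity. -/
theorem measurable_selection (hw : Antitone w) :
    Measurable (selection w : EuclideanSpace ℝ (Fin k) → EuclideanSpace ℝ (Fin k)) := by
  have he := (extend_antitone hw).measurable
  have hc : ∀ i, Measurable fun y : EuclideanSpace ℝ (Fin k) => extend w (y i) :=
    fun i => he.comp (by fun_prop)
  exact (WithLp.measurable_toLp 2 _).comp
    (measurable_pi_lambda _ fun i => (hc i).div (Finset.measurable_sum _ fun j _ => hc j))

/-! ### Fixed points and the contraction criterion -/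

/-- Fixed points of `F` are probability vectors. -/
theorem mem_simplex_of_F_eq_self (hw : Antitone w) (hw_nonneg : ∀ x, 0 ≤ w x)
    (hR : R ∈ Matrix.rowStochastic ℝ (Fin k)) {y₀ : EuclideanSpace ℝ (Fin k)}
    (hy₀ : y₀ ∈ simplex k) (hS : 0 < totalWeight w y₀) {z : EuclideanSpace ℝ (Fin k)}
    (hz : F w R z = z) : z ∈ simplex k := by
  rcases (totalWeight_nonneg hw_nonneg z).eq_or_lt with h | h
  · have hsel : selection w z = 0 := by
      ext i
      simp [selection_apply, ← h]
    rw [F_eq_rowMul, hsel, map_zero] at hz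
    have hle : totalWeight w y₀ ≤ totalWeight w z :=
      Finset.sum_le_sum fun i _ => extend_antitone hw (by simpa [← hz] using hy₀.1 i)
    exact absurd (hS.trans_le hle) (by rw [← h]; exact lt_irrefl _)
  · exact hz ▸ F_mem_simplex hw_nonneg hR h

/-- If `F` is a contraction on the simplex, it has a fixed point there. -/
theorem exists_fixedPoint_F (hw_nonneg : ∀ x, 0 ≤ w x)
    (hR : R ∈ Matrix.rowStochastic ℝ (Fin k)) {y₀ : EuclideanSpace ℝ (Fin k)}
    (hy₀ : y₀ ∈ simplex k) (hS : ∀ y ∈ simplex k, 0 < totalWeight w y) {c : ℝ≥0} (hc : c < 1)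
    (hF : LipschitzOnWith c (F w R) (simplex k)) : ∃ y ∈ simplex k, F w R y = y := by
  have hmaps : Set.MapsTo (F w R) (simplex k) (simplex k) :=
    fun y hy => F_mem_simplex hw_nonneg hR (hS y hy)
  obtain ⟨y, hy, hfix, -⟩ := ContractingWith.exists_fixedPoint' isClosed_simplex.isComplete hmaps
    ⟨hc, hF.mapsToRestrict hmaps⟩ hy₀ (edist_ne_top _ _)
  exact ⟨y, hy, hfix⟩

/-- A positive Lipschitz weight function whose Lipschitz constant is small compared with its least
value makes `F` a contraction on the simplex. -/
theorem isContractionOn_F_of_lipschitz (hw : Antitone w)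
    (hR : R ∈ Matrix.rowStochastic ℝ (Fin k)) {M : ℝ≥0} (hM : LipschitzWith M w) (hw1 : 0 < w 1)
    (hk : 2 * (M : ℝ) / w 1 < √(k : ℝ)) : IsContractionOn (F w R) (simplex k) := by
  have hsqrt : 0 < √(k : ℝ) := lt_of_le_of_lt (by positivity) hk
  have hk0 : (0 : ℝ) < k := Real.sqrt_pos.1 hsqrt
  have hle : ∀ t, w 1 ≤ extend w t := fun t => hw unitInterval.le_one'
  have hSle : ∀ y : EuclideanSpace ℝ (Fin k), k * w 1 ≤ totalWeight w y := fun y => by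
    simpa [totalWeight] using Finset.sum_le_sum fun i (_ : i ∈ Finset.univ) => hle (y i)
  have hc : 2 * (M : ℝ) / w 1 / √(k : ℝ) < 1 := (div_lt_one hsqrt).2 hk
  -- The constant arises in `ℓ¹`: the selections differ by at most `2A / S_w(x)`, with `S_w(x) ≥ k
  -- w(1)` and `A ≤ M √k ‖x - y‖`. A stochastic matrix does not increase the `ℓ¹` norm, which
  -- dominates the Euclidean one.
  refine ⟨⟨2 * (M : ℝ) / w 1 / √(k : ℝ), by positivity⟩, hc, ?_⟩
  refine LipschitzOnWith.of_dist_le_mul fun x _ y _ => ?_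
  have hSx : 0 < totalWeight w x := lt_of_lt_of_le (by positivity) (hSle x)
  have hSy : 0 < totalWeight w y := lt_of_lt_of_le (by positivity) (hSle y)
  set A := ∑ i, |extend w (x i) - extend w (y i)| with hA
  have hA0 : 0 ≤ A := Finset.sum_nonneg fun i _ => abs_nonneg _
  have hSS : |totalWeight w y - totalWeight w x| ≤ A := by
    rw [abs_sub_comm, totalWeight, totalWeight, ← Finset.sum_sub_distrib]
    exact Finset.abs_sum_le_sum_abs _ _
  have hAle : A ≤ M * (√(k : ℝ) * ‖x - y‖) := by
    calc A ≤ ∑ i, M * |(x - y) i| := Finset.sum_le_sum fun i _ => by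
          simpa using abs_extend_sub_le hM (x i) (y i)
      _ = M * ∑ i, |(x - y) i| := by rw [Finset.mul_sum]
      _ ≤ M * (√(k : ℝ) * ‖x - y‖) := by gcongr; exact sum_abs_le_sqrt_mul_norm _
  have hterm : ∀ i, |(selection w x - selection w y) i| ≤
      (totalWeight w x)⁻¹ * |extend w (x i) - extend w (y i)| +
        (totalWeight w x)⁻¹ * A * (extend w (y i) / totalWeight w y) := by
    intro i
    have hpos : 0 ≤ extend w (y i) := hw1.le.trans (hle _)
    -- This is `a/S - b/T = (a - b)/S + ((T - S)/S) (b/T)`; the factors `b/T` sum to `1`, so each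
    -- part contributes at most `A/S`.
    have heq : (selection w x - selection w y) i =
        (totalWeight w x)⁻¹ * (extend w (x i) - extend w (y i)) +
          (totalWeight w x)⁻¹ * (totalWeight w y - totalWeight w x) *
            (extend w (y i) / totalWeight w y) := by
      simp only [PiLp.sub_apply, selection_apply]
      field_simp
      ring
    rw [heq]
    refine (abs_add_le _ _).trans ?_
    rw [abs_mul, abs_mul, abs_mul, abs_of_pos (inv_pos.2 hSx),
      abs_of_nonneg (div_nonneg hpos hSy.le)]
    gcongr
  have hsel : ∑ i, |(selection w x - selection w y) i| ≤ 2 * A / totalWeight w x := by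
    refine (Finset.sum_le_sum fun i _ => hterm i).trans_eq ?_
    rw [Finset.sum_add_distrib, ← Finset.mul_sum, ← Finset.mul_sum, ← Finset.sum_div, ← hA,
      ← totalWeight, div_self hSy.ne']
    ring
  rw [dist_eq_norm, dist_eq_norm, F_eq_rowMul, F_eq_rowMul, ← map_sub]
  calc ‖rowMul R (selection w x - selection w y)‖
      ≤ ∑ i, |(selection w x - selection w y) i| :=
        (norm_le_sum_abs _).trans (sum_abs_rowMul_le hR _)
    _ ≤ 2 * (M * (√(k : ℝ) * ‖x - y‖)) / (k * w 1) := by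
        refine hsel.trans ?_
        gcongr
        exact hSle x
    _ = 2 * (M : ℝ) / w 1 / √(k : ℝ) * ‖x - y‖ := by
        have h := Real.mul_self_sqrt hk0.le
        field_simp
        rw [sq, h]
        ring

/-! ### The urn as a stochastic approximation -/

section Urn

variable
  {u₀ : EuclideanSpace ℝ (Fin k)} {Z : ℕ → Ω → Fin k}

/-- Puts running averages into recursive form, both for the proportions and for the averaged noise.
-/
theorem inv_smul_add_eq_add_smul_sub {E : Type*} [AddCommGroup E] [Module ℝ E] (n : ℕ) (b v : E) :
    ((n : ℝ) + 2)⁻¹ • (b + v) =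
      ((n : ℝ) + 1)⁻¹ • b + ((n : ℝ) + 2)⁻¹ • (v - ((n : ℝ) + 1)⁻¹ • b) := by
  have h : ((n : ℝ) + 2)⁻¹ = ((n : ℝ) + 1)⁻¹ - ((n : ℝ) + 2)⁻¹ * ((n : ℝ) + 1)⁻¹ := by
    field_simp
    ring
  rw [smul_add, smul_sub, smul_smul]
  nth_rewrite 1 [h]
  rw [sub_smul]
  abel

theorem proportions_succ (n : ℕ) (ω : Ω) :
    proportions R u₀ Z (n + 1) ω = proportions R u₀ Z n ω +
      ((n : ℝ) + 2)⁻¹ • (rowMul R (indicatorVec (Z n ω)) - proportions R u₀ Z n ω) := by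
  have h := inv_smul_add_eq_add_smul_sub n (config R u₀ Z n ω) (rowMul R (indicatorVec (Z n ω)))
  rw [proportions, proportions, ← h]
  push_cast
  rw [add_assoc (n : ℝ) 1 1, one_add_one_eq_two]
  rfl

theorem proportions_mem_simplex (hR : R ∈ Matrix.rowStochastic ℝ (Fin k)) (hu₀ : u₀ ∈ simplex k)
    (n : ℕ) (ω : Ω) : proportions R u₀ Z n ω ∈ simplex k := by
  induction n with
  | zero => simpa [proportions, config] using hu₀
  | succ n ih =>
    rw [proportions_succ]
    exact convex_simplex.add_smul_sub_mem ih
      (rowMul_mem_simplex hR (indicatorVec_mem_simplex _))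
      ⟨by positivity, inv_le_one_of_one_le₀ (by linarith [n.cast_nonneg (α := ℝ)])⟩

/-- The difference of the indicator of the selected colour and the vector of its conditional
probabilities. -/
noncomputable def noise (w : unitInterval → ℝ) (R : Matrix (Fin k) (Fin k) ℝ)
    (u₀ : EuclideanSpace ℝ (Fin k)) (Z : ℕ → Ω → Fin k) (n : ℕ) (ω : Ω) :
    EuclideanSpace ℝ (Fin k) :=
  indicatorVec (Z n ω) - selection w (proportions R u₀ Z n ω)

theorem norm_noise_le (hw_nonneg : ∀ x, 0 ≤ w x) (hR : R ∈ Matrix.rowStochastic ℝ (Fin k))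
    (hu₀ : u₀ ∈ simplex k) (hS : ∀ y ∈ simplex k, 0 < totalWeight w y) (n : ℕ) (ω : Ω) :
    ‖noise w R u₀ Z n ω‖ ≤ 2 :=
  norm_sub_le_two_of_mem_simplex (indicatorVec_mem_simplex _)
    (selection_mem_simplex hw_nonneg (hS _ (proportions_mem_simplex hR hu₀ n ω)))

/-- If the colour proportions converge to a point at which `selection w` is continuous, the colour
count proportions converge to its value there. -/
theorem tendsto_countProportions {ω : Ω} {y : EuclideanSpace ℝ (Fin k)}
    (hnoise : Tendsto (fun n : ℕ => ((n : ℝ) + 1)⁻¹ • ∑ m ∈ Finset.range n, noise w R u₀ Z m ω)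
      atTop (𝓝 0))
    (hprop : Tendsto (fun n => proportions R u₀ Z n ω) atTop (𝓝 y))
    (hcont : ContinuousAt (selection w) y) :
    Tendsto (fun n => countProportions Z n ω) atTop (𝓝 (selection w y)) := by
  -- The noise is averaged with `n + 1` and the counts with `n`; the factor `1 + 1/n` converts
  -- between them.
  have h1 : Tendsto (fun n : ℕ => 1 + ((n : ℝ))⁻¹) atTop (𝓝 (1 + 0)) :=
    tendsto_const_nhds.add tendsto_inv_atTop_nhds_zero_nat
  have h2 := (h1.smul hnoise).add (hcont.tendsto.comp hprop).cesaro_smul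
  rw [smul_zero, zero_add] at h2
  refine h2.congr' ?_
  filter_upwards [eventually_gt_atTop 0] with n hn
  have hn' : (0 : ℝ) < n := by exact_mod_cast hn
  have h3 : (1 + (n : ℝ)⁻¹) * ((n : ℝ) + 1)⁻¹ = (n : ℝ)⁻¹ := by
    field_simp
  rw [smul_smul, h3, ← smul_add, ← Finset.sum_add_distrib, countProportions, counts]
  simp [noise]

variable [mΩ : MeasurableSpace Ω] {P : Measure Ω}

/-- The filtration generated by the successively selected colours. -/
def historyFiltration (Z : ℕ → Ω → Fin k) (hZ : ∀ n, Measurable (Z n)) : Filtration ℕ mΩ where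
  seq := history Z
  mono' _ _ h := iSup_le fun i =>
    le_iSup (fun j : Fin _ => MeasurableSpace.comap (Z j) inferInstance) ⟨i, i.2.trans_le h⟩
  le' _ := iSup_le fun i => (hZ i).comap_le

variable {hZm : ∀ n, Measurable (Z n)}

theorem measurable_historyFiltration {m n : ℕ} (h : m < n) :
    Measurable[historyFiltration Z hZm n] (Z m) :=
  Measurable.of_comap_le
    (le_iSup (fun j : Fin n => MeasurableSpace.comap (Z j) inferInstance) ⟨m, h⟩)

theorem measurable_config (n : ℕ) : Measurable[historyFiltration Z hZm n] (config R u₀ Z n) := by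
  induction n with
  | zero => exact measurable_const
  | succ n ih =>
    have h1 : Measurable[historyFiltration Z hZm (n + 1)] (config R u₀ Z n) :=
      ih.mono ((historyFiltration Z hZm).mono n.le_succ) le_rfl
    have h2 : Measurable fun j : Fin k => rowMul R (indicatorVec j) := measurable_of_finite _
    exact h1.add (h2.comp (measurable_historyFiltration n.lt_succ_self))

theorem measurable_proportions (n : ℕ) :
    Measurable[historyFiltration Z hZm n] (proportions R u₀ Z n) :=
  (measurable_config n).const_smul (((n : ℝ) + 1)⁻¹)

/-- The inequality is strict because the noise at time `m` involves `Z m`, which the history up to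
`m` excludes. -/
theorem measurable_noise (hw : Antitone w) {m n : ℕ} (h : m < n) :
    Measurable[historyFiltration Z hZm n] (noise w R u₀ Z m) := by
  have h1 : Measurable fun j : Fin k => indicatorVec j := measurable_of_finite _
  have h2 : Measurable[historyFiltration Z hZm n] (proportions R u₀ Z m) :=
    (measurable_proportions m).mono ((historyFiltration Z hZm).mono h.le) le_rfl
  exact (h1.comp (measurable_historyFiltration h)).sub ((measurable_selection hw).comp h2)

theorem integrable_noise [IsFiniteMeasure P] (hZ : ∀ n, Measurable (Z n)) (hw : Antitone w)
    (hw_nonneg : ∀ x, 0 ≤ w x) (hR : R ∈ Matrix.rowStochastic ℝ (Fin k)) (hu₀ : u₀ ∈ simplex k)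
    (hS : ∀ y ∈ simplex k, 0 < totalWeight w y) (n : ℕ) : Integrable (noise w R u₀ Z n) P :=
  .of_bound ((measurable_noise (hZm := hZ) hw n.lt_succ_self).mono
    ((historyFiltration Z hZ).le _) le_rfl).aestronglyMeasurable 2
    (.of_forall (norm_noise_le hw_nonneg hR hu₀ hS n))

/-- The noise is a martingale difference sequence. -/
theorem condExp_noise [IsFiniteMeasure P] (hZ : IsUrnScheme P w R u₀ Z) (hw : Antitone w)
    (hw_nonneg : ∀ x, 0 ≤ w x) (hR : R ∈ Matrix.rowStochastic ℝ (Fin k)) (hu₀ : u₀ ∈ simplex k)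
    (hS : ∀ y ∈ simplex k, 0 < totalWeight w y) (n : ℕ) :
    P[noise w R u₀ Z n | historyFiltration Z hZ.measurable n] =ᵐ[P] 0 := by
  have hint := integrable_noise (P := P) hZ.measurable hw hw_nonneg hR hu₀ hS n
  -- The selection law is given colour by colour, so the claim is proved for each coordinate and
  -- reassembled through the projections.
  have hcoord : ∀ j, P[fun ω => noise w R u₀ Z n ω j | historyFiltration Z hZ.measurable n]
      =ᵐ[P] 0 := by
    intro j
    have hsel_mem : ∀ ω, selection w (proportions R u₀ Z n ω) ∈ simplex k := fun ω =>
      selection_mem_simplex hw_nonneg (hS _ (proportions_mem_simplex hR hu₀ n ω))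
    have hsel_meas : Measurable[historyFiltration Z hZ.measurable n]
        fun ω => selection w (proportions R u₀ Z n ω) j :=
      (show Measurable fun y : EuclideanSpace ℝ (Fin k) => y j by fun_prop).comp
        ((measurable_selection hw).comp (measurable_proportions n))
    have hsel_int : Integrable (fun ω => selection w (proportions R u₀ Z n ω) j) P :=
      .of_bound (hsel_meas.mono ((historyFiltration Z hZ.measurable).le n)
        le_rfl).aestronglyMeasurable 1
        (.of_forall fun ω => (PiLp.norm_apply_le _ j).trans
          (norm_le_one_of_mem_simplex (hsel_mem ω)))
    have hind_int : Integrable ((Z n ⁻¹' {j}).indicator fun _ => (1 : ℝ)) P :=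
      (integrable_const 1).indicator (hZ.measurable n (measurableSet_singleton j))
    have heq : (fun ω => noise w R u₀ Z n ω j) =
        ((Z n ⁻¹' {j}).indicator fun _ => (1 : ℝ)) -
          fun ω => selection w (proportions R u₀ Z n ω) j := by
      ext ω
      by_cases h : Z n ω = j
      · simp [noise, indicatorVec, h]
      · simp [noise, indicatorVec, h, Ne.symm h]
    rw [heq]
    filter_upwards [condExp_sub hind_int hsel_int (historyFiltration Z hZ.measurable n),
      hZ.condProb n j] with ω h1 h2
    rw [h1, Pi.sub_apply, condExp_of_stronglyMeasurable
      ((historyFiltration Z hZ.measurable).le n) hsel_meas.stronglyMeasurable hsel_int]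
    exact sub_eq_zero.2 h2
  filter_upwards [ae_all_iff.2 hcoord, ae_all_iff.2 fun j =>
    (EuclideanSpace.proj (𝕜 := ℝ) j).comp_condExp_comm hint
      (m := historyFiltration Z hZ.measurable n)] with ω h1 h2
  ext j
  exact (h2 j).trans (h1 j)

/-- The colour proportions converge almost surely to a fixed point of `F`, if `F` is a contraction
on the simplex. -/
theorem ae_tendsto_proportions [IsProbabilityMeasure P] (hZ : IsUrnScheme P w R u₀ Z)
    (hw : Antitone w) (hw_nonneg : ∀ x, 0 ≤ w x) (hR : R ∈ Matrix.rowStochastic ℝ (Fin k))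
    (hu₀ : u₀ ∈ simplex k) (hS : ∀ y ∈ simplex k, 0 < totalWeight w y) {c : ℝ≥0} (hc : c < 1)
    (hF : LipschitzOnWith c (F w R) (simplex k)) {y : EuclideanSpace ℝ (Fin k)}
    (hy : y ∈ simplex k) (hfix : F w R y = y) :
    ∀ᵐ ω ∂P, Tendsto (fun n => proportions R u₀ Z n ω) atTop (𝓝 y) := by
  have hmem : ∀ n ω, proportions R u₀ Z n ω ∈ simplex k := proportions_mem_simplex hR hu₀
  have h := ae_tendsto_zero_of_contracting_recursion (P := P)
    (ℱ := historyFiltration Z hZ.measurable) (c := c) (B := 2)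
    (X := fun n ω => proportions R u₀ Z n ω - y)
    (G := fun n ω => F w R (proportions R u₀ Z n ω) - y)
    (D := fun n ω => rowMul R (noise w R u₀ Z n ω))
    (by exact_mod_cast hc)
    (fun n => ((measurable_proportions n).sub_const y).stronglyMeasurable)
    (fun n => ((rowMul R).measurable.comp ((measurable_noise (hZm := hZ.measurable) hw
      n.lt_succ_self).mono ((historyFiltration Z hZ.measurable).le _) le_rfl)).stronglyMeasurable)
    (fun n ω => norm_sub_le_two_of_mem_simplex (hmem n ω) hy)
    (fun n ω => by
      rw [noise, map_sub]
      exact norm_sub_le_two_of_mem_simplex (rowMul_mem_simplex hR (indicatorVec_mem_simplex _))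
        (F_mem_simplex hw_nonneg hR (hS _ (hmem n ω))))
    (fun n ω => by
      -- Replacing `y` by `F y` makes the drift a difference of two values of `F`.
      nth_rewrite 1 [← hfix]
      simpa [dist_eq_norm] using hF.dist_le_mul _ (hmem n ω) _ hy)
    (fun n => by
      filter_upwards [condExp_noise hZ hw hw_nonneg hR hu₀ hS n,
        (rowMul R).comp_condExp_comm (integrable_noise hZ.measurable hw hw_nonneg hR hu₀ hS n)
          (m := historyFiltration Z hZ.measurable n)] with ω h1 h2
      refine h2.symm.trans ?_
      simp [h1])
    (fun n ω => by
      rw [proportions_succ, noise, map_sub, F_eq_rowMul, add_sub_right_comm]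
      congr 2
      abel)
  filter_upwards [h] with ω hω
  simpa using hω.add_const y

/-- The averaged noise converges almost surely to `0`. -/
theorem ae_tendsto_average_noise [IsProbabilityMeasure P] (hZ : IsUrnScheme P w R u₀ Z)
    (hw : Antitone w) (hw_nonneg : ∀ x, 0 ≤ w x) (hR : R ∈ Matrix.rowStochastic ℝ (Fin k))
    (hu₀ : u₀ ∈ simplex k) (hS : ∀ y ∈ simplex k, 0 < totalWeight w y) :
    ∀ᵐ ω ∂P, Tendsto
      (fun n : ℕ => ((n : ℝ) + 1)⁻¹ • ∑ m ∈ Finset.range n, noise w R u₀ Z m ω) atTop (𝓝 0) := by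
  have hbound := norm_noise_le (Z := Z) hw_nonneg hR hu₀ hS
  -- The average over `m < n`, divided by `n + 1`, obeys the recursion with zero drift.
  refine ae_tendsto_zero_of_contracting_recursion (P := P)
    (ℱ := historyFiltration Z hZ.measurable) (c := 0) (B := 2) (G := fun _ _ => 0)
    (D := noise w R u₀ Z) zero_lt_one
    (fun n => ?_)
    (fun n => ((measurable_noise (hZm := hZ.measurable) hw
      n.lt_succ_self).mono ((historyFiltration Z hZ.measurable).le _) le_rfl).stronglyMeasurable)
    (fun n ω => ?_) hbound (fun n ω => by simp)
    (condExp_noise hZ hw hw_nonneg hR hu₀ hS) (fun n ω => ?_)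
  · exact ((Finset.measurable_fun_sum _ fun m hm =>
      measurable_noise hw (Finset.mem_range.1 hm)).const_smul (((n : ℝ) + 1)⁻¹)).stronglyMeasurable
  · have h1 : ‖∑ m ∈ Finset.range n, noise w R u₀ Z m ω‖ ≤ n * 2 := by
      simpa using norm_sum_le_of_le (Finset.range n) fun m _ => hbound m ω
    rw [norm_smul, Real.norm_of_nonneg (by positivity), inv_mul_le_iff₀ (by positivity)]
    linarith
  · rw [Finset.sum_range_succ, zero_sub, neg_add_eq_sub, ← inv_smul_add_eq_add_smul_sub]
    push_cast
    rw [add_assoc (n : ℝ) 1 1, one_add_one_eq_two]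

/-- The urn scheme converges if `F` is a contraction on the simplex. -/
theorem converges_of_isContractionOn [IsProbabilityMeasure P] (hZ : IsUrnScheme P w R u₀ Z)
    (hw : Antitone w) (hw_nonneg : ∀ x, 0 ≤ w x) (hR : R ∈ Matrix.rowStochastic ℝ (Fin k))
    (hu₀ : u₀ ∈ simplex k) (hcont : Continuous w) (hS : ∀ y ∈ simplex k, 0 < totalWeight w y)
    (hF : IsContractionOn (F w R) (simplex k)) : Converges P w R u₀ Z := by
  obtain ⟨c, hc, hF⟩ := hF
  obtain ⟨y, hy, hfix⟩ := exists_fixedPoint_F hw_nonneg hR hu₀ hS hc hF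
  have hprop := ae_tendsto_proportions hZ hw hw_nonneg hR hu₀ hS hc hF hy hfix
  refine ⟨y, hy, hfix, fun z hz => ?_, hprop, ?_⟩
  -- The contraction holds only on the simplex; uniqueness in the whole space follows because every
  -- fixed point lies there.
  · have hzm := mem_simplex_of_F_eq_self hw hw_nonneg hR hu₀ (hS _ hu₀) hz
    have h := hF.dist_le_mul z hzm y hy
    rw [hz, hfix] at h
    have hc' : (c : ℝ) < 1 := by exact_mod_cast hc
    exact dist_le_zero.1 (by nlinarith [dist_nonneg (x := z) (y := y)])
  · filter_upwards [hprop, ae_tendsto_average_noise hZ hw hw_nonneg hR hu₀ hS] with ω h1 h2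
    exact tendsto_countProportions h2 h1 (continuousAt_selection hcont (hS y hy))

end Urn

end NegUrn

theorem mainTheorem2 {k : ℕ} {Ω : Type*} [MeasurableSpace Ω] (P : Measure Ω)
    [IsProbabilityMeasure P]
    (w : unitInterval → ℝ) (hw : Antitone w) (hw_nonneg : ∀ x, 0 ≤ w x)
    (R : Matrix (Fin k) (Fin k) ℝ) (hR : R ∈ Matrix.rowStochastic ℝ (Fin k))
    (u₀ : EuclideanSpace ℝ (Fin k)) (hu₀ : u₀ ∈ NegUrn.simplex k)
    (Z : ℕ → Ω → Fin k) (hZ : NegUrn.IsUrnScheme P w R u₀ Z) :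
    (Continuous w → (∀ y ∈ NegUrn.simplex k, 0 < NegUrn.totalWeight w y) →
      NegUrn.IsContractionOn (NegUrn.F w R) (NegUrn.simplex k) →
      NegUrn.Converges P w R u₀ Z) ∧
    (∀ M : ℝ≥0, LipschitzWith M w → 0 < w 1 → 2 * (M : ℝ) / w 1 < √(k : ℝ) →
      NegUrn.Converges P w R u₀ Z) := by
  refine ⟨NegUrn.converges_of_isContractionOn hZ hw hw_nonneg hR hu₀, fun M hM hw1 hk => ?_⟩
  refine NegUrn.converges_of_isContractionOn hZ hw hw_nonneg hR hu₀ hM.continuous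
    (fun y hy => ?_) (NegUrn.isContractionOn_F_of_lipschitz hw hR hM hw1 hk)
  have hle : ∀ t, w 1 ≤ NegUrn.extend w t := fun t => hw unitInterval.le_one'
  -- There is at least one colour, since the entries of `y` sum to `1`.
  have hne : (Finset.univ : Finset (Fin k)).Nonempty :=
    Finset.nonempty_of_sum_ne_zero (f := fun i => y i) (by rw [hy.2]; exact one_ne_zero)
  exact Finset.sum_pos (fun i _ => hw1.trans_le (hle _)) hne
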